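/- Let $d\ge 1$ and let $\lambda$ be a nonzero Lévy measure on $\mathbb{R}$ with $\int_{\mathbb{R}}|z|\,\lambda(\mathrm{d}z)<\infty$. Let $\mu$ be a Poisson random measure on $(0,\infty)\times\mathbb{R}^d\times\mathbb{R}$ with intensity measure $\mathrm{d}t\,\mathrm{d}x\,\lambda(\mathrm{d}z)$, let $m\in\mathbb{R}$, put $m_0=m-\int_{\mathbb{R}}z\,\lambda(\mathrm{d}z)$, and let $$\Lambda(\mathrm{d}t,\mathrm{d}x)=m_0\,\mathrm{d}t\,\mathrm{d}x+\int_{\mathbb{R}}z\,\mu(\mathrm{d}t,\mathrm{d}x,\mathrm{d}z)$$ be the corresponding Lévy space-time white noise with mean $m$. Let $$Y(t,x)=\int_0^t\int_{\mathbb{R}^d}g(t-s,x-y)\,\Lambda(\mathrm{d}s,\mathrm{d}y),\qquad g(t,x)=\frac{1}{(4\pi t)^{d/2}}e^{-|x|^2/(4t)}\mathbf{1}_{t>0},$$ be the mild solution of the stochastic heat equation $\partial_tY=\Delta Y+\dot\Lambda$ on $(0,\infty)\times\mathbb{R}^d$ with $Y(0,\cdot)=0$, and write $Y_0(t)=Y(t,0)$.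 Suppose that for some $\varepsilon>0$ $$\int_{\mathbb{R}}|z|^{1+\varepsilon}\,\lambda(\mathrm{d}z)<\infty\qquad\text{and}\qquad\int_{[-1,1]}\bigl|z\log|z|\bigr|\,\lambda(\mathrm{d}z)<\infty .$$ Then for every $p\in(0,1+\varepsilon]\cap(0,1+2/d)$ the following holds: for every $t>0$ the integral defining $Y_0(t)$ converges absolutely almost surely and $Y_0(t)/t\in L^p$; and $$\frac{Y_0(t)}{t}\longrightarrow m\quad\text{in }L^p\text{ as }t\to\infty,\qquad\text{that is,}\qquad \lim_{t\to\infty}\mathbb{E}\left[\left|\frac{Y_0(t)}{t}-m\right|^p\right]=0 .$$ -/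

import Mathlib

open MeasureTheory ProbabilityTheory Filter Topology
open scoped ENNReal NNReal

noncomputable section

namespace LevyHeat

/-- The spatial domain `ℝ^d` with its Euclidean norm. -/
abbrev Space (d : ℕ) : Type := EuclideanSpace ℝ (Fin d)

/-- The Poisson distribution with mean `a ∈ [0, ∞]`, as a law on `[0, ∞]`; for `a = ∞` it is the
point mass at `∞`. -/
def poissonLaw (a : ℝ≥0∞) : Measure ℝ≥0∞ :=
  if a = ∞ then Measure.dirac ∞
  else (poissonMeasure a.toNNReal).map (fun n : ℕ => (n : ℝ≥0∞))

/-- `μ` is a Poisson random measure on `E` with intensity measure `ν`, on the probability space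
`(Ω, P)`. -/
structure IsPoissonRandomMeasure {Ω E : Type*} [MeasurableSpace Ω] [MeasurableSpace E]
    (μ : Ω → Measure E) (ν : Measure E) (P : Measure Ω) : Prop where
  measurable : ∀ A : Set E, MeasurableSet A → Measurable (fun ω => μ ω A)
  law : ∀ A : Set E, MeasurableSet A → P.map (fun ω => μ ω A) = poissonLaw (ν A)
  indep : ∀ (n : ℕ) (A : Fin n → Set E), (∀ i, MeasurableSet (A i)) →
    Pairwise (fun i j => Disjoint (A i) (A j)) → iIndepFun (fun i ω => μ ω (A i)) P

/-- A Lévy measure on `ℝ`. -/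
structure IsLevyMeasure (lam : Measure ℝ) : Prop where
  zero : lam {0} = 0
  integrable : Integrable (fun z : ℝ => min 1 (z ^ 2)) lam

/-- The intensity measure `dt dx λ(dz)` on `(0, ∞) × ℝ^d × ℝ`, seen as a measure on
`ℝ × ℝ^d × ℝ` that is carried by positive times. -/
def intensity (d : ℕ) (lam : Measure ℝ) : Measure (ℝ × Space d × ℝ) :=
  ((volume : Measure ℝ).restrict (Set.Ioi 0)).prod ((volume : Measure (Space d)).prod lam)

/-- The drift `m₀ = m - ∫ z λ(dz)` of the noise with mean `m`. -/
def drift (m : ℝ) (lam : Measure ℝ) : ℝ := m - ∫ z, z ∂lam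

/-- The integral `∫ h dΛ` of a deterministic function `h(s, y)` with respect to
`Λ(ds, dy) = m₀ ds dy + ∫_ℝ z μ(ds, dy, dz)`, on the outcome whose jump measure is `μω`. -/
def noiseIntegral {d : ℕ} (m : ℝ) (lam : Measure ℝ) (μω : Measure (ℝ × Space d × ℝ))
    (h : ℝ → Space d → ℝ) : ℝ :=
  drift m lam * (∫ q : ℝ × Space d, h q.1 q.2 ∂(((volume : Measure ℝ).restrict (Set.Ioi 0)).prod volume))
    + ∫ q : ℝ × Space d × ℝ, h q.1 q.2.1 * q.2.2 ∂μω

/-- Both integrals in `noiseIntegral` converge absolutely. -/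
def NoiseIntegrable {d : ℕ} (μω : Measure (ℝ × Space d × ℝ)) (h : ℝ → Space d → ℝ) : Prop :=
  Integrable (fun q : ℝ × Space d => h q.1 q.2)
      (((volume : Measure ℝ).restrict (Set.Ioi 0)).prod volume) ∧
    Integrable (fun q : ℝ × Space d × ℝ => h q.1 q.2.1 * q.2.2) μω

/-- The heat kernel `g(t, x)` of `∂_t - Δ` on `ℝ^d`, extended by `0` to `t ≤ 0`. -/
def heatKernel (d : ℕ) (t : ℝ) (x : Space d) : ℝ :=
  if 0 < t then
    1 / (4 * Real.pi * t) ^ ((d : ℝ) / 2) * Real.exp (-(‖x‖ ^ 2) / (4 * t))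
  else 0

/-- The integrand `1_{(0, t]}(s) g(t - s, x - y)` of the mild solution at `(t, x)`. -/
def mildKernel {d : ℕ} (t : ℝ) (x : Space d) : ℝ → Space d → ℝ := fun s y =>
  (Set.Ioc 0 t).indicator (fun s => heatKernel d (t - s) (x - y)) s

/-- The mild solution `Y(t, x) = ∫_0^t ∫ g(t - s, x - y) Λ(ds, dy)` of
`∂_t Y = Δ Y + Λ̇`, `Y(0, ·) = 0`, as a random variable. -/
def mildSolution {Ω : Type*} {d : ℕ} (m : ℝ) (lam : Measure ℝ)
    (μ : Ω → Measure (ℝ × Space d × ℝ)) (t : ℝ) (x : Space d) (ω : Ω) : ℝ :=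
  noiseIntegral m lam (μ ω) (mildKernel t x)

end LevyHeat

end

/-
The deviation `Y(t, x) / t - m` is the integral of `t⁻¹ g(t - s, x - y) z` against the compensated
Poisson measure, so everything follows from an `L^p` bound for compensated Poisson integrals.
For a finite sum `S = ∑ aᵢ (Nᵢ - rᵢ)` of independent compensated Poisson variables, Mecke's identity
`E[N φ(N)] = r E[φ(N + 1)]` applied to the odd power `φ(S) = |S| ^ (p - 1) sign S` gives
`E|S| ^ p = ∑ rᵢ aᵢ E[φ(S + aᵢ) - φ(S)]`. The increment of `φ` is bounded by a multiple of
`|aᵢ| ^ (p - 1)`, plus a multiple of `|aᵢ| |S| ^ (p - 2)` if `p > 2`; that last term is absorbed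
into the left-hand side, and the outcome is a Rosenthal-type bound by the `L^p` and `L^(min p 2)`
norms of the integrand with respect to the intensity, which passes to general integrands by
approximation.
For the averaged heat kernel the `L^q` norm is a constant times `t ^ (-(d / 2 + 1) (1 - 1 / q))`,
and it is finite exactly when `d (q - 1) < 2`. Exponents `p ≤ 1` follow from some `q > 1`.
-/

noncomputable section

namespace LevyHeat

/-- The odd power function `x ↦ sign x * |x| ^ (p - 1)`, the derivative of `x ↦ |x| ^ p / p`. -/
def oddPow (p x : ℝ) : ℝ := x * |x| ^ (p - 2)

/-- The constant in the moment inequality for compensated Poisson integrals. -/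
def momentConst (p : ℝ) : ℝ := p * 2 ^ p

section OddPow

variable {p x y : ℝ}

lemma one_le_momentConst (hp : 1 ≤ p) : 1 ≤ momentConst p :=
  one_le_mul_of_one_le_of_one_le hp (Real.one_le_rpow one_le_two (by linarith))

lemma abs_rpow_eq_sq_mul (hp : p ≠ 0) (x : ℝ) : |x| ^ p = x ^ 2 * |x| ^ (p - 2) := by
  rw [← sq_abs, ← Real.rpow_two, ← Real.rpow_add' (abs_nonneg x) (by simpa), add_sub_cancel]

lemma mul_oddPow (hp : p ≠ 0) (x : ℝ) : x * oddPow p x = |x| ^ p := by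
  rw [abs_rpow_eq_sq_mul hp, oddPow]
  ring

lemma abs_oddPow (hp : 1 < p) (x : ℝ) : |oddPow p x| = |x| ^ (p - 1) := by
  rw [oddPow, abs_mul, abs_of_nonneg (Real.rpow_nonneg (abs_nonneg x) _),
    ← Real.rpow_one_add' (abs_nonneg x) (by linarith)]
  ring_nf

lemma oddPow_nonneg (hx : 0 ≤ x) : 0 ≤ oddPow p x := by
  unfold oddPow
  positivity

lemma oddPow_of_nonneg (hp : 1 < p) (hx : 0 ≤ x) : oddPow p x = x ^ (p - 1) := by
  rw [← abs_of_nonneg (oddPow_nonneg hx), abs_oddPow hp, abs_of_nonneg hx]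

lemma oddPow_neg (p x : ℝ) : oddPow p (-x) = -oddPow p x := by
  simp [oddPow]

lemma measurable_oddPow (p : ℝ) : Measurable (oddPow p) := by
  unfold oddPow
  fun_prop

lemma rpow_sub_rpow_le_mul_sub {q : ℝ} (hq : 1 ≤ q) (hx : 0 ≤ x) (hxy : x ≤ y) :
    y ^ q - x ^ q ≤ q * y ^ (q - 1) * (y - x) := by
  rcases (hx.trans hxy).eq_or_lt with rfl | hy
  · simp [le_antisymm hxy hx]
  have bernoulli : 1 + q * (x / y - 1) ≤ (x / y) ^ q := by
    simpa using one_add_mul_self_le_rpow_one_add (s := x / y - 1)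
      (by linarith [div_nonneg hx hy.le]) hq
  rw [Real.div_rpow hx hy.le, le_div_iff₀ (by positivity)] at bernoulli
  rw [Real.rpow_sub_one hy.ne']
  calc y ^ q - x ^ q ≤ y ^ q - (1 + q * (x / y - 1)) * y ^ q := by gcongr
    _ = q * (y ^ q / y) * (y - x) := by field_simp; ring

lemma oddPow_sub_oddPow_le (hp : 1 < p) (hp2 : p ≤ 2) (hxy : x ≤ y) :
    oddPow p y - oddPow p x ≤ 2 * (y - x) ^ (p - 1) := by
  have of_nonneg : ∀ {x y : ℝ}, 0 ≤ x → x ≤ y →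
      oddPow p y - oddPow p x ≤ 2 * (y - x) ^ (p - 1) := fun {x y} hx hxy => by
    rw [oddPow_of_nonneg hp hx, oddPow_of_nonneg hp (hx.trans hxy)]
    have hadd := Real.rpow_add_le_add_rpow hx (sub_nonneg.2 hxy) (by linarith : 0 ≤ p - 1)
      (by linarith)
    rw [add_sub_cancel] at hadd
    linarith [Real.rpow_nonneg (sub_nonneg.2 hxy) (p - 1)]
  rcases le_total 0 x with hx | hx
  · exact of_nonneg hx hxy
  rcases le_total y 0 with hy | hy
  · have h := of_nonneg (neg_nonneg.2 hy) (neg_le_neg hxy)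
    rw [oddPow_neg, oddPow_neg, neg_sub_neg, neg_sub_neg] at h
    exact h
  · have hx' : 0 ≤ -x := neg_nonneg.2 hx
    rw [← neg_neg x, oddPow_neg, oddPow_of_nonneg hp hx', oddPow_of_nonneg hp hy, two_mul,
      sub_neg_eq_add, sub_neg_eq_add]
    gcongr <;> linarith

lemma oddPow_sub_oddPow_le_of_two_le (hp : 2 ≤ p) (hxy : x ≤ y) :
    oddPow p y - oddPow p x ≤ p * max |x| |y| ^ (p - 2) * (y - x) := by
  have hp1 : 1 < p := by linarith
  have of_nonneg : ∀ {x y : ℝ}, 0 ≤ x → x ≤ y →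
      oddPow p y - oddPow p x ≤ p * max |x| |y| ^ (p - 2) * (y - x) := fun {x y} hx hxy => by
    have hy := hx.trans hxy
    rw [oddPow_of_nonneg hp1 hx, oddPow_of_nonneg hp1 hy, abs_of_nonneg hx, abs_of_nonneg hy,
      max_eq_right hxy, show p - 2 = p - 1 - 1 by ring]
    refine (rpow_sub_rpow_le_mul_sub (by linarith) hx hxy).trans ?_
    gcongr
    linarith
  rcases le_total 0 x with hx | hx
  · exact of_nonneg hx hxy
  rcases le_total y 0 with hy | hy
  · have h := of_nonneg (neg_nonneg.2 hy) (neg_le_neg hxy)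
    rw [oddPow_neg, oddPow_neg, neg_sub_neg, neg_sub_neg, abs_neg, abs_neg, max_comm] at h
    exact h
  · calc oddPow p y - oddPow p x = y * |y| ^ (p - 2) + -x * |x| ^ (p - 2) := by
          unfold oddPow; ring
      _ ≤ y * max |x| |y| ^ (p - 2) + -x * max |x| |y| ^ (p - 2) := by
          gcongr
          · exact le_max_right _ _
          · exact neg_nonneg.2 hx
          · exact le_max_left _ _
      _ = 1 * max |x| |y| ^ (p - 2) * (y - x) := by ring
      _ ≤ p * max |x| |y| ^ (p - 2) * (y - x) := by
          gcongr

lemma mul_oddPow_add_sub_le_of_two_le (hp : 2 ≤ p) (x : ℝ) {a : ℝ} (ha : 0 ≤ a) :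
    a * (oddPow p (x + a) - oddPow p x) ≤ momentConst p * (a ^ p + a ^ 2 * |x| ^ (p - 2)) := by
  have hmax : max |x| |x + a| ≤ 2 * max a |x| := by
    rw [two_mul]
    refine max_le ?_ ((abs_add_le x a).trans ?_)
    · linarith [le_max_right a |x|, le_max_left a |x|]
    · rw [abs_of_nonneg ha, add_comm]
      exact add_le_add (le_max_left _ _) (le_max_right _ _)
  have hpow : max |x| |x + a| ^ (p - 2) ≤ 2 ^ p * (a ^ (p - 2) + |x| ^ (p - 2)) := by
    calc max |x| |x + a| ^ (p - 2) ≤ (2 * max a |x|) ^ (p - 2) := by gcongr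
      _ = 2 ^ (p - 2) * max a |x| ^ (p - 2) := Real.mul_rpow zero_le_two (by positivity)
      _ ≤ 2 ^ p * (a ^ (p - 2) + |x| ^ (p - 2)) := by
        gcongr
        · exact one_le_two
        · linarith
        · rw [Real.rpow_max ha (abs_nonneg x) (by linarith)]
          exact max_le_add_of_nonneg (by positivity) (by positivity)
  calc a * (oddPow p (x + a) - oddPow p x)
      ≤ a * (p * max |x| |x + a| ^ (p - 2) * (x + a - x)) := by
        gcongr
        exact oddPow_sub_oddPow_le_of_two_le hp (by linarith)
    _ ≤ a * (p * (2 ^ p * (a ^ (p - 2) + |x| ^ (p - 2))) * (x + a - x)) := by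
        rw [add_sub_cancel_left]
        gcongr
    _ = momentConst p * (a ^ p + a ^ 2 * |x| ^ (p - 2)) := by
        rw [← abs_of_nonneg ha, abs_rpow_eq_sq_mul (by linarith : p ≠ 0) a, abs_of_nonneg ha,
          momentConst]
        ring

lemma mul_oddPow_add_sub_le (hp : 1 < p) (x a : ℝ) :
    a * (oddPow p (x + a) - oddPow p x)
      ≤ momentConst p * (|a| ^ p + |a| ^ min p 2 * |x| ^ (p - min p 2)) := by
  wlog ha : 0 ≤ a generalizing x a
  · have h := this (-x) (-a) (by linarith)
    rwa [← neg_add, oddPow_neg, oddPow_neg, neg_sub_neg, abs_neg, abs_neg, neg_mul_comm,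
      neg_sub] at h
  rw [abs_of_nonneg ha]
  rcases le_total p 2 with hp2 | hp2
  · have hdiff : oddPow p (x + a) - oddPow p x ≤ 2 * a ^ (p - 1) := by
      simpa using oddPow_sub_oddPow_le hp hp2 (show x ≤ x + a by linarith)
    rw [min_eq_left hp2, sub_self, Real.rpow_zero, mul_one, ← two_mul]
    calc a * (oddPow p (x + a) - oddPow p x) ≤ a * (2 * a ^ (p - 1)) := by gcongr
      _ = 1 * (2 * a ^ (1 + (p - 1))) := by
        rw [Real.rpow_one_add' ha (by linarith)]
        ring
      _ ≤ momentConst p * (2 * a ^ p) := by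
        rw [add_sub_cancel]
        gcongr
        exact one_le_momentConst hp.le
  · rw [min_eq_right hp2, Real.rpow_two]
    exact mul_oddPow_add_sub_le_of_two_le hp2 x ha

end OddPow

section Absorption

lemma mul_rpow_lt_rpow_of_mul_lt {c u x q : ℝ} (hc : 1 ≤ c) (hu : 0 ≤ u) (hq : 1 ≤ q)
    (h : c * u < x) : c * u ^ q < x ^ q :=
  calc c * u ^ q ≤ c ^ q * u ^ q := by
        gcongr
        exact Real.self_le_rpow_of_one_le hc hq
    _ = (c * u) ^ q := (Real.mul_rpow (by linarith) hu).symm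
    _ < x ^ q := Real.rpow_lt_rpow (by positivity) h (by linarith)

lemma le_of_rpow_le_add_mul_rpow {K m p u v x : ℝ} (hK : 1 ≤ K) (hm : 1 ≤ m) (hmp : m ≤ p)
    (hu : 0 ≤ u) (hv : 0 ≤ v) (h : x ^ p ≤ K * (u ^ p + v ^ m * x ^ (p - m))) :
    x ≤ 2 * K * (u + v) := by
  by_contra! hlt
  have hx : 0 < x := hlt.trans_le' (by positivity)
  have hupow : 2 * K * u ^ p < x ^ p :=
    mul_rpow_lt_rpow_of_mul_lt (by linarith) hu (hm.trans hmp) (hlt.trans_le' (by gcongr; linarith))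
  have hvpow : 2 * K * v ^ m < x ^ m :=
    mul_rpow_lt_rpow_of_mul_lt (by linarith) hv hm (hlt.trans_le' (by gcongr; linarith))
  have hvx : 2 * K * v ^ m * x ^ (p - m) < x ^ p := by
    calc 2 * K * v ^ m * x ^ (p - m) < x ^ m * x ^ (p - m) := by gcongr
      _ = x ^ p := by rw [← Real.rpow_add hx, add_sub_cancel]
  linarith

end Absorption

section Jensen

variable {Ω : Type*} [MeasurableSpace Ω] {P : Measure Ω} {f : Ω → ℝ} {θ : ℝ}

lemma integrable_rpow_of_le_one [IsFiniteMeasure P] (hf : Integrable f P) (hf0 : ∀ ω, 0 ≤ f ω)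
    (hθ0 : 0 ≤ θ) (hθ1 : θ ≤ 1) : Integrable (fun ω => f ω ^ θ) P := by
  have hθ : ENNReal.ofReal θ ≤ 1 := by simpa using hθ1
  simpa [ENNReal.toReal_ofReal hθ0, abs_of_nonneg (hf0 _)] using
    ((memLp_one_iff_integrable.2 hf).mono_exponent hθ).integrable_norm_rpow'

lemma integral_rpow_le_rpow_integral [IsProbabilityMeasure P] (hf : Integrable f P)
    (hf0 : ∀ ω, 0 ≤ f ω) (hθ0 : 0 ≤ θ) (hθ1 : θ ≤ 1) :
    ∫ ω, f ω ^ θ ∂P ≤ (∫ ω, f ω ∂P) ^ θ :=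
  (Real.concaveOn_rpow hθ0 hθ1).le_map_integral (Real.continuous_rpow_const hθ0).continuousOn
    isClosed_Ici (ae_of_all _ hf0) hf (integrable_rpow_of_le_one hf hf0 hθ0 hθ1)

end Jensen

section Poisson

variable {Ω : Type*} [MeasurableSpace Ω] {P : Measure Ω}

lemma natCast_succ_mul_poissonMeasure_singleton (r : ℝ≥0) (n : ℕ) :
    ((n + 1 : ℕ) : ℝ≥0∞) * poissonMeasure r {n + 1} = r * poissonMeasure r {n} := by
  rw [poissonMeasure_singleton, poissonMeasure_singleton, ← ENNReal.ofReal_natCast,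
    ← ENNReal.ofReal_coe_nnreal, ← ENNReal.ofReal_mul (by positivity),
    ← ENNReal.ofReal_mul (by positivity), Nat.factorial_succ]
  congr 1
  push_cast
  field_simp
  ring

lemma poissonMeasure_withDensity_natCast (r : ℝ≥0) :
    (poissonMeasure r).withDensity (fun n : ℕ => ((n : ℝ≥0) : ℝ≥0∞))
      = r • (poissonMeasure r).map (· + 1) := by
  refine Measure.ext_of_singleton fun n => ?_
  rw [withDensity_apply _ (measurableSet_singleton n), lintegral_singleton, Measure.smul_apply,
    Measure.map_apply (by fun_prop) (measurableSet_singleton n)]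
  cases n with
  | zero =>
    have : (fun k : ℕ => k + 1) ⁻¹' {0} = ∅ := by ext; simp
    simp [this]
  | succ n =>
    have : (fun k : ℕ => k + 1) ⁻¹' {n + 1} = {n} := by ext; simp
    rw [this]
    exact natCast_succ_mul_poissonMeasure_singleton r n

lemma lintegral_natCast_poissonMeasure (r : ℝ≥0) :
    ∫⁻ n : ℕ, (n : ℝ≥0∞) ∂poissonMeasure r = r := by
  have h := congr($(poissonMeasure_withDensity_natCast r) Set.univ)
  rw [withDensity_apply _ MeasurableSet.univ, setLIntegral_univ, Measure.smul_apply,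
    Measure.map_apply (by fun_prop) MeasurableSet.univ, Set.preimage_univ, measure_univ] at h
  simpa [ENNReal.smul_def] using h

lemma integrable_exp_mul_poissonMeasure (r : ℝ≥0) (s : ℝ) :
    Integrable (fun n : ℕ => Real.exp (s * n)) (poissonMeasure r) := by
  rw [integrable_poissonMeasure_iff]
  refine ((Real.summable_pow_div_factorial (r * Real.exp s)).mul_left (Real.exp (-r))).congr
    fun n => ?_
  rw [Real.norm_of_nonneg (Real.exp_pos _).le, mul_pow, ← Real.exp_nat_mul, mul_comm (n : ℝ) s]
  ring

lemma memLp_natCast_of_hasLaw_poissonMeasure {r : ℝ≥0} {N : Ω → ℕ}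
    (hN : HasLaw N (poissonMeasure r) P) (q : ℝ≥0) : MemLp (fun ω => (N ω : ℝ)) q P := by
  have huniv : integrableExpSet (fun n : ℕ => (n : ℝ)) (poissonMeasure r) = Set.univ :=
    Set.eq_univ_of_forall (integrable_exp_mul_poissonMeasure r)
  have h : MemLp (fun n : ℕ => (n : ℝ)) q (P.map N) := by
    rw [hN.map_eq]
    exact memLp_of_mem_interior_integrableExpSet (by simp [huniv]) q
  exact h.comp_of_map hN.aemeasurable

lemma integral_natCast_mul_of_indepFun_poisson [IsProbabilityMeasure P] {r : ℝ≥0} {T : Ω → ℝ}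
    {N : Ω → ℕ} (hT : AEMeasurable T P) (hN : HasLaw N (poissonMeasure r) P)
    (hind : IndepFun T N P) {k : ℝ × ℕ → ℝ} (hk : Measurable k) :
    ∫ ω, (N ω : ℝ) * k (T ω, N ω) ∂P = r * ∫ ω, k (T ω, N ω + 1) ∂P := by
  have : IsProbabilityMeasure (P.map T) := Measure.isProbabilityMeasure_map hT
  have hN' := hN.aemeasurable
  have hprod := (indepFun_iff_map_prod_eq_prod_map_map hT hN').1 hind
  rw [hN.map_eq] at hprod
  have transfer : ∀ g : ℝ × ℕ → ℝ, Measurable g →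
      ∫ ω, g (T ω, N ω) ∂P = ∫ x, g x ∂(P.map T).prod (poissonMeasure r) := fun g hg => by
    rw [← hprod, integral_map (hT.prodMk hN') hg.aestronglyMeasurable]
  have hdensity := integral_withDensity_eq_integral_smul (μ := (P.map T).prod (poissonMeasure r))
    (f := fun x => (x.2 : ℝ≥0)) (by fun_prop) k
  rw [← prod_withDensity_right (g := fun n : ℕ => ((n : ℝ≥0) : ℝ≥0∞)) (by fun_prop),
    poissonMeasure_withDensity_natCast] at hdensity
  have hshift : (P.map T).prod (r • (poissonMeasure r).map (· + 1))
      = r • ((P.map T).prod (poissonMeasure r)).map (Prod.map id (· + 1)) := by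
    rw [← Measure.map_prod_map _ _ measurable_id (by fun_prop), Measure.map_id]
    exact Measure.prod_smul_right (r : ℝ≥0∞)
  rw [hshift, integral_smul_nnreal_measure, integral_map (by fun_prop) hk.aestronglyMeasurable]
    at hdensity
  simp only [NNReal.smul_def, NNReal.coe_natCast, smul_eq_mul] at hdensity
  rw [transfer (fun x => (x.2 : ℝ) * k x) (by fun_prop), ← hdensity,
    transfer (fun x => k (x.1, x.2 + 1)) (by fun_prop)]
  rfl

end Poisson

section Integrability

variable {Ω : Type*} [MeasurableSpace Ω] {P : Measure Ω} {p : ℝ} {X Y : Ω → ℝ}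

lemma integrable_abs_rpow (hp : 0 < p) (hX : MemLp X (ENNReal.ofReal p) P) :
    Integrable (fun ω => |X ω| ^ p) P := by
  simpa [ENNReal.toReal_ofReal hp.le] using
    hX.integrable_norm_rpow (by simpa using hp) ENNReal.ofReal_ne_top

lemma integrable_mul_oddPow (hp : 1 < p) (hX : MemLp X (ENNReal.ofReal p) P)
    (hY : MemLp Y (ENNReal.ofReal p) P) : Integrable (fun ω => X ω * oddPow p (Y ω)) P := by
  have hp0 : 0 < p := by linarith
  have hmeas : AEStronglyMeasurable (fun ω => X ω * oddPow p (Y ω)) P :=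
    hX.1.mul ((measurable_oddPow p).comp_aemeasurable hY.1.aemeasurable).aestronglyMeasurable
  refine ((integrable_abs_rpow hp0 hX).add (integrable_abs_rpow hp0 hY)).mono' hmeas
    (ae_of_all _ fun ω => ?_)
  rw [Real.norm_eq_abs, abs_mul, abs_oddPow hp]
  calc |X ω| * |Y ω| ^ (p - 1)
      ≤ max |X ω| |Y ω| * max |X ω| |Y ω| ^ (p - 1) := by
        gcongr
        · exact le_max_left _ _
        · exact le_max_right _ _
    _ = max (|X ω| ^ p) (|Y ω| ^ p) := by
        rw [← Real.rpow_one_add' (by positivity) (by linarith), add_sub_cancel,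
          Real.rpow_max (abs_nonneg _) (abs_nonneg _) hp0.le]
    _ ≤ |X ω| ^ p + |Y ω| ^ p := max_le_add_of_nonneg (by positivity) (by positivity)

lemma integrable_oddPow [IsFiniteMeasure P] (hp : 1 < p) (hX : MemLp X (ENNReal.ofReal p) P) :
    Integrable (fun ω => oddPow p (X ω)) P := by
  simpa using integrable_mul_oddPow hp (memLp_const (1 : ℝ)) hX

end Integrability

/-- The compensated sum `∑ i, a i * (N i - r i)`, where `N i` counts the Poisson points at which a
simple function takes the value `a i` and `r i` is the expected number of such points. -/
def compensatedSum {Ω ι : Type*} [Fintype ι] (a : ι → ℝ) (N : ι → Ω → ℕ) (r : ι → ℝ≥0)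
    (ω : Ω) : ℝ :=
  ∑ i, a i * ((N i ω : ℝ) - r i)

section CompensatedSum

variable {Ω : Type*} [MeasurableSpace Ω] {P : Measure Ω} {ι : Type*} [Fintype ι]
  {N : ι → Ω → ℕ} {r : ι → ℝ≥0} {p : ℝ}

lemma indepFun_sum_erase [DecidableEq ι] (hN : ∀ i, AEMeasurable (N i) P) (hind : iIndepFun N P)
    {f : ι → ℕ → ℝ} (i : ι) :
    IndepFun (fun ω => ∑ j ∈ Finset.univ.erase i, f j (N j ω)) (N i) P := by
  have h := (hind.indepFun_finset₀ (Finset.univ.erase i) {i} (by simp) hN).comp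
    (φ := fun x : Finset.univ.erase i → ℕ => ∑ j : Finset.univ.erase i, f j (x j))
    (ψ := fun x : ({i} : Finset ι) → ℕ => x ⟨i, by simp⟩) (by fun_prop)
    (Measurable.of_discrete)
  refine h.congr (ae_of_all _ fun ω => ?_) (ae_of_all _ fun ω => rfl)
  exact Finset.sum_coe_sort (Finset.univ.erase i) fun j => f j (N j ω)

variable [IsProbabilityMeasure P]

lemma memLp_compensatedSum (hN : ∀ i, HasLaw (N i) (poissonMeasure (r i)) P) (a : ι → ℝ)
    (q : ℝ≥0) : MemLp (compensatedSum a N r) q P :=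
  memLp_finsetSum _ fun i _ =>
    ((memLp_natCast_of_hasLaw_poissonMeasure (hN i) q).sub (memLp_const _)).const_mul (a i)

lemma integral_natCast_mul_comp_compensatedSum (hN : ∀ i, HasLaw (N i) (poissonMeasure (r i)) P)
    (hind : iIndepFun N P) (a : ι → ℝ) {φ : ℝ → ℝ} (hφ : Measurable φ) (i : ι) :
    ∫ ω, (N i ω : ℝ) * φ (compensatedSum a N r ω) ∂P
      = r i * ∫ ω, φ (compensatedSum a N r ω + a i) ∂P := by
  classical
  have hN' := fun i => (hN i).aemeasurable
  have hsplit : ∀ ω, compensatedSum a N r ω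
      = ∑ j ∈ Finset.univ.erase i, a j * ((N j ω : ℝ) - r j) + a i * ((N i ω : ℝ) - r i) :=
    fun ω => (Finset.sum_erase_add _ _ (Finset.mem_univ i)).symm
  have mecke := integral_natCast_mul_of_indepFun_poisson (by fun_prop) (hN i)
    (indepFun_sum_erase hN' hind (f := fun j n => a j * ((n : ℝ) - r j)) i)
    (k := fun x => φ (x.1 + a i * ((x.2 : ℝ) - r i))) (by fun_prop)
  simp_rw [hsplit, mecke]
  congr! 4 with ω
  push_cast
  ring

lemma integral_abs_rpow_compensatedSum (hN : ∀ i, HasLaw (N i) (poissonMeasure (r i)) P)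
    (hind : iIndepFun N P) (a : ι → ℝ) (hp : 1 < p) :
    ∫ ω, |compensatedSum a N r ω| ^ p ∂P
      = ∑ i, r i * ∫ ω, a i * (oddPow p (compensatedSum a N r ω + a i)
          - oddPow p (compensatedSum a N r ω)) ∂P := by
  have hS := memLp_compensatedSum hN a p.toNNReal
  have hNφ : ∀ i, Integrable (fun ω => (N i ω : ℝ) * oddPow p (compensatedSum a N r ω)) P :=
    fun i => integrable_mul_oddPow hp (memLp_natCast_of_hasLaw_poissonMeasure (hN i) _) hS
  have hφ := integrable_oddPow hp hS
  have hφ_add : ∀ i, Integrable (fun ω => oddPow p (compensatedSum a N r ω + a i)) P :=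
    fun i => integrable_oddPow hp (hS.add (memLp_const (a i)))
  have hexpand : ∀ ω, |compensatedSum a N r ω| ^ p
      = ∑ i, a i * ((N i ω : ℝ) - r i) * oddPow p (compensatedSum a N r ω) := fun ω => by
    rw [← mul_oddPow (by linarith), ← Finset.sum_mul, compensatedSum]
  have hterm : ∀ i ω, a i * ((N i ω : ℝ) - r i) * oddPow p (compensatedSum a N r ω)
      = a i * ((N i ω : ℝ) * oddPow p (compensatedSum a N r ω)
          - r i * oddPow p (compensatedSum a N r ω)) := fun i ω => by ring
  simp_rw [hexpand, hterm]
  rw [integral_finsetSum _ fun i _ => ((hNφ i).sub' (hφ.const_mul _)).const_mul _]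
  refine Finset.sum_congr rfl fun i _ => ?_
  rw [integral_const_mul, integral_const_mul, integral_sub (hNφ i) (hφ.const_mul _),
    integral_sub (hφ_add i) hφ, integral_const_mul,
    integral_natCast_mul_comp_compensatedSum hN hind a (measurable_oddPow p) i]
  ring

lemma integral_mul_oddPow_add_sub_le (hp : 1 < p) {X : Ω → ℝ} (hX : MemLp X (ENNReal.ofReal p) P)
    (b : ℝ) :
    ∫ ω, b * (oddPow p (X ω + b) - oddPow p (X ω)) ∂P
      ≤ momentConst p * (|b| ^ p + |b| ^ min p 2 * (∫ ω, |X ω| ^ p ∂P) ^ ((p - min p 2) / p)) := by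
  have hp0 : 0 < p := by linarith
  have hlow : 0 ≤ (p - min p 2) / p := div_nonneg (sub_nonneg.2 (min_le_left _ _)) hp0.le
  have hone : (p - min p 2) / p ≤ 1 :=
    (div_le_one hp0).2 (sub_le_self _ (le_min hp0.le zero_le_two))
  have hXp := integrable_abs_rpow hp0 hX
  have hroot : ∀ ω, |X ω| ^ (p - min p 2) = (|X ω| ^ p) ^ ((p - min p 2) / p) := fun ω => by
    rw [← Real.rpow_mul (abs_nonneg _), mul_div_cancel₀ _ hp0.ne']
  have hint : Integrable (fun ω => |X ω| ^ (p - min p 2)) P := by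
    simp_rw [hroot]
    exact integrable_rpow_of_le_one hXp (fun ω => by positivity) hlow hone
  calc ∫ ω, b * (oddPow p (X ω + b) - oddPow p (X ω)) ∂P
      ≤ ∫ ω, momentConst p * (|b| ^ p + |b| ^ min p 2 * |X ω| ^ (p - min p 2)) ∂P := by
        refine integral_mono (((integrable_oddPow hp (hX.add (memLp_const b))).sub'
          (integrable_oddPow hp hX)).const_mul b)
          (((integrable_const _).fun_add (hint.const_mul _)).const_mul _) fun ω => ?_
        exact mul_oddPow_add_sub_le hp (X ω) b
    _ = momentConst p * (|b| ^ p + |b| ^ min p 2 * ∫ ω, |X ω| ^ (p - min p 2) ∂P) := by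
        rw [integral_const_mul, integral_add (integrable_const _) (hint.const_mul _),
          integral_const_mul]
        simp
    _ ≤ _ := by
        have := one_le_momentConst hp.le
        simp_rw [hroot]
        gcongr
        exact integral_rpow_le_rpow_integral hXp (fun ω => by positivity) hlow hone

lemma integral_abs_rpow_compensatedSum_le (hN : ∀ i, HasLaw (N i) (poissonMeasure (r i)) P)
    (hind : iIndepFun N P) (a : ι → ℝ) (hp : 1 < p) :
    (∫ ω, |compensatedSum a N r ω| ^ p ∂P) ^ p⁻¹
      ≤ 2 * momentConst p * ((∑ i, |a i| ^ p * r i) ^ p⁻¹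
        + (∑ i, |a i| ^ min p 2 * r i) ^ (min p 2)⁻¹) := by
  have hp0 : 0 < p := by linarith
  have hm : 1 ≤ min p 2 := le_min hp.le one_le_two
  have hS := memLp_compensatedSum hN a p.toNNReal
  set M := ∫ ω, |compensatedSum a N r ω| ^ p ∂P
  have hM : 0 ≤ M := integral_nonneg fun ω => by positivity
  have hsum : ∀ q : ℝ, 0 ≤ ∑ i, |a i| ^ q * r i := fun q =>
    Finset.sum_nonneg fun i _ => by positivity
  have hmoment : M ≤ momentConst p * (∑ i, |a i| ^ p * r i
      + (∑ i, |a i| ^ min p 2 * r i) * M ^ ((p - min p 2) / p)) :=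
    calc M = ∑ i, r i * ∫ ω, a i * (oddPow p (compensatedSum a N r ω + a i)
            - oddPow p (compensatedSum a N r ω)) ∂P := integral_abs_rpow_compensatedSum hN hind a hp
      _ ≤ ∑ i, r i * (momentConst p
            * (|a i| ^ p + |a i| ^ min p 2 * M ^ ((p - min p 2) / p))) := by
          gcongr with i
          exact integral_mul_oddPow_add_sub_le hp hS (a i)
      _ = _ := by
          rw [Finset.sum_mul, ← Finset.sum_add_distrib, Finset.mul_sum]
          exact Finset.sum_congr rfl fun i _ => by ring
  refine le_of_rpow_le_add_mul_rpow (one_le_momentConst hp.le) hm (min_le_left _ _)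
    (Real.rpow_nonneg (hsum _) _) (Real.rpow_nonneg (hsum _) _) ?_
  rwa [Real.rpow_inv_rpow hM hp0.ne', Real.rpow_inv_rpow (hsum _) hp0.ne',
    Real.rpow_inv_rpow (hsum _) (by linarith), ← Real.rpow_mul hM, inv_mul_eq_div]

end CompensatedSum

section PoissonLaw

lemma lintegral_poissonLaw (a : ℝ≥0∞) : ∫⁻ x, x ∂poissonLaw a = a := by
  unfold poissonLaw
  split_ifs with h
  · simp [h]
  · rw [lintegral_map (f := fun x => x) measurable_id (by fun_prop),
      lintegral_natCast_poissonMeasure, ENNReal.coe_toNNReal h]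

lemma map_floor_poissonLaw {a : ℝ≥0∞} (ha : a ≠ ∞) :
    (poissonLaw a).map (fun x => ⌊x.toReal⌋₊) = poissonMeasure a.toNNReal := by
  rw [poissonLaw, if_neg ha, Measure.map_map (by fun_prop) (by fun_prop)]
  convert Measure.map_id
  ext n
  simp

lemma ae_poissonLaw_floor_eq {a : ℝ≥0∞} (ha : a ≠ ∞) :
    ∀ᵐ x ∂poissonLaw a, (⌊x.toReal⌋₊ : ℝ) = x.toReal := by
  rw [poissonLaw, if_neg ha, ae_map_iff (by fun_prop)
    (measurableSet_eq_fun (by fun_prop) (by fun_prop))]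
  simp

end PoissonLaw

section SimpleFunc

variable {E : Type*} [MeasurableSpace E]

/-- The nonzero values of a simple function, which index its level sets of finite measure. -/
def nonzeroRange (g : SimpleFunc E ℝ) : Finset ℝ := {y ∈ g.range | y ≠ 0}

lemma measure_preimage_nonzeroRange_ne_top {g : SimpleFunc E ℝ} {ν : Measure E}
    (hg : Integrable g ν) (y : nonzeroRange g) : ν (g ⁻¹' {(y : ℝ)}) ≠ ∞ :=
  (SimpleFunc.integrable_iff.1 hg _ (Finset.mem_filter.1 y.2).2).ne

lemma integral_simpleFunc_eq_sum {g : SimpleFunc E ℝ} {ν : Measure E} (hg : Integrable g ν) :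
    ∫ x, g x ∂ν = ∑ y : nonzeroRange g, (y : ℝ) * ν.real (g ⁻¹' {(y : ℝ)}) := by
  rw [← SimpleFunc.integral_eq_integral _ hg, SimpleFunc.integral_eq_sum_filter,
    Finset.sum_coe_sort (nonzeroRange g) fun y => y * ν.real (g ⁻¹' {y})]
  exact Finset.sum_congr rfl fun y _ => mul_comm _ _

lemma eLpNorm_simpleFunc_eq_sum {g : SimpleFunc E ℝ} {ν : Measure E} (hg : Integrable g ν)
    {q : ℝ} (hq : 0 < q) :
    eLpNorm g (ENNReal.ofReal q) ν = ENNReal.ofReal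
      ((∑ y : nonzeroRange g, |(y : ℝ)| ^ q * (ν (g ⁻¹' {(y : ℝ)})).toNNReal) ^ q⁻¹) := by
  have hsum : ∫⁻ x, ‖g x‖ₑ ^ q ∂ν = ∑ y ∈ nonzeroRange g, ‖y‖ₑ ^ q * ν (g ⁻¹' {y}) := by
    rw [nonzeroRange, Finset.sum_filter_of_ne, ← SimpleFunc.map_lintegral (fun y : ℝ => ‖y‖ₑ ^ q),
      ← SimpleFunc.lintegral_eq_lintegral]
    · rfl
    · rintro y - hy rfl
      simp [hq] at hy
  rw [eLpNorm_eq_lintegral_rpow_enorm_toReal (by simpa using hq) ENNReal.ofReal_ne_top,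
    ENNReal.toReal_ofReal hq.le, hsum, one_div, ← ENNReal.ofReal_rpow_of_nonneg
      (Finset.sum_nonneg fun y _ => by positivity) (inv_nonneg.2 hq.le),
    ENNReal.ofReal_sum_of_nonneg fun y _ => by positivity, ← Finset.sum_coe_sort (nonzeroRange g)]
  congr 1
  refine Finset.sum_congr rfl fun y _ => ?_
  rw [ENNReal.ofReal_mul (by positivity), ← ENNReal.ofReal_rpow_of_nonneg (abs_nonneg _) hq.le,
    Real.enorm_eq_ofReal_abs, ENNReal.ofReal_coe_nnreal,
    ENNReal.coe_toNNReal (measure_preimage_nonzeroRange_ne_top hg y)]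

end SimpleFunc

/-- The integral of `f` against the compensated random measure `μ - ν`. -/
def compensatedIntegral {Ω E : Type*} [MeasurableSpace E] (μ : Ω → Measure E) (ν : Measure E)
    (f : E → ℝ) (ω : Ω) : ℝ :=
  ∫ x, f x ∂μ ω - ∫ x, f x ∂ν

lemma tendsto_compensatedIntegral_of_dominated {Ω E : Type*} [MeasurableSpace E]
    {μ : Ω → Measure E} {ν : Measure E} {g : ℕ → E → ℝ} {f : E → ℝ} {ω : Ω}
    (hg : ∀ n, Measurable (g n)) (hgf : ∀ n x, ‖g n x‖ ≤ 2 * ‖f x‖)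
    (hlim : ∀ x, Tendsto (fun n => g n x) atTop (𝓝 (f x))) (hfν : Integrable f ν)
    (hfω : Integrable f (μ ω)) :
    Tendsto (fun n => compensatedIntegral μ ν (g n) ω) atTop
      (𝓝 (compensatedIntegral μ ν f ω)) := by
  have hconv : ∀ ρ : Measure E, Integrable f ρ →
      Tendsto (fun n => ∫ x, g n x ∂ρ) atTop (𝓝 (∫ x, f x ∂ρ)) := fun ρ hρ =>
    tendsto_integral_of_dominated_convergence (fun x => 2 * ‖f x‖)
      (fun n => (hg n).aestronglyMeasurable) (hρ.norm.const_mul 2)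
      (fun n => ae_of_all _ (hgf n)) (ae_of_all _ hlim)
  exact (hconv _ hfω).sub (hconv _ hfν)

/-- The number of points of the random measure `μ` in `A`. The mass of `A` is almost surely an
integer when its expectation is finite; taking the integer part makes it one everywhere. -/
def pointCount {Ω E : Type*} [MeasurableSpace E] (μ : Ω → Measure E) (A : Set E) (ω : Ω) : ℕ :=
  ⌊(μ ω A).toReal⌋₊

namespace IsPoissonRandomMeasure

variable {Ω E : Type*} [MeasurableSpace Ω] [MeasurableSpace E] {P : Measure Ω}
  {μ : Ω → Measure E} {ν : Measure E}

/-- A Poisson random measure as a transition kernel. -/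
def toKernel (hμ : IsPoissonRandomMeasure μ ν P) : Kernel Ω E :=
  ⟨μ, Measure.measurable_of_measurable_coe _ hμ.measurable⟩

lemma toKernel_comp (hμ : IsPoissonRandomMeasure μ ν P) : hμ.toKernel ∘ₘ P = ν := by
  ext A hA
  rw [Measure.bind_apply hA hμ.toKernel.aemeasurable]
  change ∫⁻ ω, μ ω A ∂P = ν A
  rw [← lintegral_map (f := fun x => x) measurable_id (hμ.measurable A hA), hμ.law A hA,
    lintegral_poissonLaw]

lemma ae_integrable (hμ : IsPoissonRandomMeasure μ ν P) {f : E → ℝ} (hf : Integrable f ν) :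
    ∀ᵐ ω ∂P, Integrable f (μ ω) :=
  Measure.ae_integrable_of_integrable_comp (κ := hμ.toKernel) (hμ.toKernel_comp.symm ▸ hf)

lemma aestronglyMeasurable_compensatedIntegral (hμ : IsPoissonRandomMeasure μ ν P) {f : E → ℝ}
    (hf : AEStronglyMeasurable f ν) : AEStronglyMeasurable (compensatedIntegral μ ν f) P := by
  have hmk : ∀ᵐ ω ∂P, ∀ᵐ x ∂hμ.toKernel ω, f x = hf.mk f x :=
    Measure.ae_ae_of_ae_comp (hμ.toKernel_comp.symm ▸ hf.ae_eq_mk)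
  have hint : AEStronglyMeasurable (fun ω => ∫ x, f x ∂μ ω) P :=
    ⟨_, hf.stronglyMeasurable_mk.integral_kernel (κ := hμ.toKernel),
      hmk.mono fun _ hω => integral_congr_ae hω⟩
  exact hint.sub aestronglyMeasurable_const

lemma hasLaw_pointCount (hμ : IsPoissonRandomMeasure μ ν P) {A : Set E} (hA : MeasurableSet A)
    (hνA : ν A ≠ ∞) : HasLaw (pointCount μ A) (poissonMeasure (ν A).toNNReal) P where
  aemeasurable := (hμ.measurable A hA).ennreal_toReal.nat_floor.aemeasurable
  map_eq := by
    rw [← map_floor_poissonLaw hνA, ← hμ.law A hA,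
      Measure.map_map (by fun_prop) (hμ.measurable A hA)]
    rfl

lemma ae_pointCount_eq (hμ : IsPoissonRandomMeasure μ ν P) {A : Set E} (hA : MeasurableSet A)
    (hνA : ν A ≠ ∞) : ∀ᵐ ω ∂P, (pointCount μ A ω : ℝ) = (μ ω).real A := by
  have h := ae_poissonLaw_floor_eq hνA
  rw [← hμ.law A hA] at h
  exact ae_of_ae_map (hμ.measurable A hA).aemeasurable h

lemma iIndepFun_pointCount (hμ : IsPoissonRandomMeasure μ ν P) {ι : Type*} [Finite ι]
    {A : ι → Set E} (hA : ∀ i, MeasurableSet (A i)) (hdisj : Pairwise (Function.onFun Disjoint A)) :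
    iIndepFun (fun i => pointCount μ (A i)) P := by
  let e := (Finite.equivFin ι).symm
  have hfin := hμ.indep _ (A ∘ e) (fun k => hA (e k)) (hdisj.comp_of_injective e.injective)
  have hι : iIndepFun (fun i ω => μ ω (A i)) P := by
    simpa [Function.comp_def] using hfin.precomp e.symm.injective
  exact hι.comp (fun _ x => ⌊x.toReal⌋₊) fun _ => by fun_prop

lemma compensatedIntegral_simpleFunc_ae_eq (hμ : IsPoissonRandomMeasure μ ν P)
    {g : SimpleFunc E ℝ} (hg : Integrable g ν) :
    compensatedIntegral μ ν g =ᵐ[P] compensatedSum (fun y : nonzeroRange g => (y : ℝ))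
      (fun y => pointCount μ (g ⁻¹' {(y : ℝ)})) (fun y => (ν (g ⁻¹' {(y : ℝ)})).toNNReal) := by
  have hcount : ∀ᵐ ω ∂P, ∀ y : nonzeroRange g,
      (pointCount μ (g ⁻¹' {(y : ℝ)}) ω : ℝ) = (μ ω).real (g ⁻¹' {(y : ℝ)}) :=
    ae_all_iff.2 fun y => hμ.ae_pointCount_eq (g.measurableSet_fiber _)
      (measure_preimage_nonzeroRange_ne_top hg y)
  filter_upwards [hcount, hμ.ae_integrable hg] with ω hω hgω
  rw [compensatedIntegral, integral_simpleFunc_eq_sum hgω, integral_simpleFunc_eq_sum hg,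
    ← Finset.sum_sub_distrib]
  refine Finset.sum_congr rfl fun y _ => ?_
  rw [hω y, mul_sub]
  rfl

variable [IsProbabilityMeasure P] {p : ℝ}

lemma eLpNorm_compensatedIntegral_simpleFunc_le (hμ : IsPoissonRandomMeasure μ ν P)
    {g : SimpleFunc E ℝ} (hg : Integrable g ν) (hp : 1 < p) :
    eLpNorm (compensatedIntegral μ ν g) (ENNReal.ofReal p) P
      ≤ ENNReal.ofReal (2 * momentConst p)
        * (eLpNorm g (ENNReal.ofReal p) ν + eLpNorm g (ENNReal.ofReal (min p 2)) ν) := by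
  have hp0 : 0 < p := by linarith
  have hN := fun y : nonzeroRange g => hμ.hasLaw_pointCount (g.measurableSet_fiber (y : ℝ))
    (measure_preimage_nonzeroRange_ne_top hg y)
  have hind := hμ.iIndepFun_pointCount (fun y : nonzeroRange g => g.measurableSet_fiber (y : ℝ))
    fun y z hyz => Disjoint.preimage _ (by simpa [Subtype.val_inj] using hyz)
  have hbound := integral_abs_rpow_compensatedSum_le hN hind (fun y => (y : ℝ)) hp
  have hconst := one_le_momentConst hp.le
  rw [eLpNorm_congr_ae (hμ.compensatedIntegral_simpleFunc_ae_eq hg), ENNReal.ofReal,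
    (memLp_compensatedSum hN _ p.toNNReal).eLpNorm_eq_integral_rpow_norm (by simpa using hp0)
      ENNReal.coe_ne_top, ← ENNReal.ofReal,
    eLpNorm_simpleFunc_eq_sum hg hp0, eLpNorm_simpleFunc_eq_sum hg (by positivity),
    ← ENNReal.ofReal_add (by positivity) (by positivity), ← ENNReal.ofReal_mul (by positivity)]
  refine ENNReal.ofReal_le_ofReal ?_
  simpa [hp0.le] using hbound

theorem eLpNorm_compensatedIntegral_le (hμ : IsPoissonRandomMeasure μ ν P) {f : E → ℝ}
    (hf : Measurable f) (hint : Integrable f ν) (hp : 1 < p) :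
    eLpNorm (compensatedIntegral μ ν f) (ENNReal.ofReal p) P
      ≤ ENNReal.ofReal (4 * momentConst p)
        * (eLpNorm f (ENNReal.ofReal p) ν + eLpNorm f (ENNReal.ofReal (min p 2)) ν) := by
  let g : ℕ → SimpleFunc E ℝ := SimpleFunc.approxOn f hf Set.univ 0 (Set.mem_univ 0)
  have hgf : ∀ n x, ‖g n x‖ ≤ 2 * ‖f x‖ := fun n x => by
    rw [two_mul]
    exact SimpleFunc.norm_approxOn_zero_le hf (Set.mem_univ 0) x n
  have hlim : ∀ x, Tendsto (fun n => g n x) atTop (𝓝 (f x)) := fun x =>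
    SimpleFunc.tendsto_approxOn hf (Set.mem_univ 0) (by simp)
  have hgint : ∀ n, Integrable (g n) ν := fun n =>
    (hint.norm.const_mul 2).mono' (g n).measurable.aestronglyMeasurable (ae_of_all _ (hgf n))
  have hgnorm : ∀ n q, eLpNorm (g n) q ν ≤ ENNReal.ofReal 2 * eLpNorm f q ν := fun n q =>
    eLpNorm_le_mul_eLpNorm_of_ae_le_mul (ae_of_all _ (hgf n)) q
  have hbound : ∀ n, eLpNorm (compensatedIntegral μ ν (g n)) (ENNReal.ofReal p) P
      ≤ ENNReal.ofReal (4 * momentConst p)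
        * (eLpNorm f (ENNReal.ofReal p) ν + eLpNorm f (ENNReal.ofReal (min p 2)) ν) := fun n => by
    refine (hμ.eLpNorm_compensatedIntegral_simpleFunc_le (hgint n) hp).trans
      ((mul_le_mul_right (add_le_add (hgnorm n _) (hgnorm n _)) _).trans_eq ?_)
    rw [← mul_add, ← mul_assoc, ← ENNReal.ofReal_mul (by linarith [one_le_momentConst hp.le])]
    ring_nf
  refine (Lp.eLpNorm_lim_le_liminf_eLpNorm (fun n =>
    hμ.aestronglyMeasurable_compensatedIntegral (hgint n).aestronglyMeasurable) _ ?_).trans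
    (liminf_le_of_le (by isBoundedDefault) fun b hb => ?_)
  · filter_upwards [hμ.ae_integrable hint] with ω hω
    exact tendsto_compensatedIntegral_of_dominated (fun n => (g n).measurable) hgf hlim hint hω
  · obtain ⟨n, hn⟩ := hb.exists
    exact hn.trans (hbound n)

end IsPoissonRandomMeasure

section LpNorms

variable {X Y : Type*} [MeasurableSpace X] [MeasurableSpace Y] {μ : Measure X} {ν : Measure Y}

lemma eLpNorm_mul_prod [SFinite ν] {f : X → ℝ} {g : Y → ℝ} (hf : AEStronglyMeasurable f μ)
    (hg : AEStronglyMeasurable g ν) {p : ℝ≥0∞} (hp0 : p ≠ 0) (hp : p ≠ ∞) :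
    eLpNorm (fun z : X × Y => f z.1 * g z.2) p (μ.prod ν) = eLpNorm f p μ * eLpNorm g p ν := by
  simp only [eLpNorm_eq_lintegral_rpow_enorm_toReal hp0 hp, enorm_mul,
    ENNReal.mul_rpow_of_nonneg _ _ ENNReal.toReal_nonneg]
  rw [lintegral_prod_mul (hf.enorm.pow_const _) (hg.enorm.pow_const _),
    ENNReal.mul_rpow_of_nonneg _ _ (by positivity)]

lemma memLp_of_le_of_le {f : X → ℝ} {p q r : ℝ} (hp : 0 < p) (hpq : p ≤ q) (hqr : q ≤ r)
    (hfp : MemLp f (ENNReal.ofReal p) μ) (hfr : MemLp f (ENNReal.ofReal r) μ) :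
    MemLp f (ENNReal.ofReal q) μ := by
  have hq : 0 < q := hp.trans_le hpq
  have hr : 0 < r := hq.trans_le hqr
  have hle : ∀ a : ℝ, 0 ≤ a → a ^ q ≤ a ^ p + a ^ r := fun a ha => by
    rcases le_total a 1 with h | h
    · exact (Real.rpow_le_rpow_of_exponent_ge_of_imp ha h hpq fun _ hq' =>
        absurd hq' hq.ne').trans (le_add_of_nonneg_right (by positivity))
    · exact (Real.rpow_le_rpow_of_exponent_le h hqr).trans
        (le_add_of_nonneg_left (by positivity))
  have hmeas := hfp.aestronglyMeasurable
  rw [← integrable_norm_rpow_iff hmeas (by simpa using hp) ENNReal.ofReal_ne_top,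
    ENNReal.toReal_ofReal hp.le] at hfp
  rw [← integrable_norm_rpow_iff hmeas (by simpa using hr) ENNReal.ofReal_ne_top,
    ENNReal.toReal_ofReal hr.le] at hfr
  rw [← integrable_norm_rpow_iff hmeas (by simpa using hq) ENNReal.ofReal_ne_top,
    ENNReal.toReal_ofReal hq.le]
  refine (hfp.add hfr).mono' (hmeas.norm.aemeasurable.pow_const q).aestronglyMeasurable
    (ae_of_all _ fun x => ?_)
  rw [Real.norm_of_nonneg (by positivity)]
  exact hle _ (norm_nonneg _)

lemma memLp_of_integrable_of_le {f : X → ℝ} {q r : ℝ} (hq : 1 ≤ q) (hqr : q ≤ r)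
    (hf : Integrable f μ) (hfr : MemLp f (ENNReal.ofReal r) μ) : MemLp f (ENNReal.ofReal q) μ :=
  memLp_of_le_of_le one_pos hq hqr (by simpa using memLp_one_iff_integrable.2 hf) hfr

end LpNorms

section HeatKernel

variable {d : ℕ}

lemma heatKernel_nonneg (t : ℝ) (x : Space d) : 0 ≤ heatKernel d t x := by
  unfold heatKernel
  split_ifs <;> positivity

lemma heatKernel_of_nonpos {t : ℝ} (ht : t ≤ 0) (x : Space d) : heatKernel d t x = 0 :=
  if_neg ht.not_gt

lemma measurable_heatKernel : Measurable fun z : ℝ × Space d => heatKernel d z.1 z.2 :=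
  Measurable.ite (measurableSet_lt measurable_const measurable_fst) (by fun_prop)
    measurable_const

lemma mildKernel_nonneg (t : ℝ) (x : Space d) (s : ℝ) (y : Space d) : 0 ≤ mildKernel t x s y :=
  Set.indicator_nonneg (fun _ _ => heatKernel_nonneg _ _) _

lemma measurable_mildKernel (t : ℝ) (x : Space d) :
    Measurable fun z : ℝ × Space d => mildKernel t x z.1 z.2 :=
  (measurable_heatKernel.comp (g := fun z : ℝ × Space d => heatKernel d z.1 z.2)
    (f := fun z : ℝ × Space d => (t - z.1, x - z.2)) (by fun_prop)).indicator
    (measurable_fst measurableSet_Ioc)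

/-- The constant in `∫ g(u, y) ^ q dy = heatConst d q * u ^ (-d (q - 1) / 2)`. -/
def heatConst (d : ℕ) (q : ℝ) : ℝ :=
  q ^ (-(d / 2 : ℝ)) * (4 * Real.pi) ^ (-(d / 2 * (q - 1) : ℝ))

lemma heatConst_pos (d : ℕ) {q : ℝ} (hq : 0 < q) : 0 < heatConst d q := by
  unfold heatConst
  positivity

@[simp]
lemma heatConst_one (d : ℕ) : heatConst d 1 = 1 := by
  simp [heatConst]

lemma enorm_heatKernel_rpow {u q : ℝ} (hu : 0 < u) (hq : 0 ≤ q) (y : Space d) :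
    ‖heatKernel d u y‖ₑ ^ q = ENNReal.ofReal
      ((4 * Real.pi * u) ^ (-(d / 2 * q : ℝ)) * Real.exp (-(q / (4 * u)) * ‖y‖ ^ 2)) := by
  have hpi : 0 ≤ 4 * Real.pi * u := by positivity
  rw [Real.enorm_eq_ofReal (heatKernel_nonneg _ _),
    ENNReal.ofReal_rpow_of_nonneg (heatKernel_nonneg _ _) hq, heatKernel, if_pos hu,
    Real.mul_rpow (by positivity) (by positivity), ← Real.exp_mul, one_div,
    ← Real.rpow_neg hpi, ← Real.rpow_mul hpi]
  congr 3
  · ring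
  · field_simp

lemma lintegral_heatKernel_rpow {u q : ℝ} (hu : 0 < u) (hq : 0 < q) :
    ∫⁻ y : Space d, ‖heatKernel d u y‖ₑ ^ q
      = ENNReal.ofReal (heatConst d q * u ^ (-(d / 2 * (q - 1) : ℝ))) := by
  have hpi : 0 < 4 * Real.pi * u := by positivity
  have hgauss : ∫ y : Space d, Real.exp (-(q / (4 * u)) * ‖y‖ ^ 2)
      = (Real.pi / (q / (4 * u))) ^ (d / 2 : ℝ) := by
    simpa using GaussianFourier.integral_rexp_neg_mul_sq_norm (V := Space d)
      (by positivity : 0 < q / (4 * u))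
  have hint : Integrable fun y : Space d => Real.exp (-(q / (4 * u)) * ‖y‖ ^ 2) :=
    .of_integral_ne_zero (by rw [hgauss]; positivity)
  simp_rw [enorm_heatKernel_rpow hu hq.le]
  rw [← ofReal_integral_eq_lintegral_ofReal (hint.const_mul _)
    (ae_of_all _ fun y => by positivity), integral_const_mul, hgauss,
    show Real.pi / (q / (4 * u)) = q⁻¹ * (4 * Real.pi * u) by field_simp,
    Real.mul_rpow (by positivity) hpi.le, Real.inv_rpow hq.le, ← Real.rpow_neg hq.le,
    mul_left_comm, ← Real.rpow_add hpi, heatConst, mul_assoc (q ^ _),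
    ← Real.mul_rpow (by positivity) hu.le]
  ring_nf

lemma lintegral_mildKernel_rpow_space {t q : ℝ} (hq : 0 < q) (x : Space d) (s : ℝ) :
    ∫⁻ y, ‖mildKernel t x s y‖ₑ ^ q = (Set.Ioo 0 t).indicator
      (fun s => ENNReal.ofReal (heatConst d q * (t - s) ^ (-(d / 2 * (q - 1) : ℝ)))) s := by
  by_cases hs : s ∈ Set.Ioo 0 t
  · simp only [mildKernel, Set.indicator_of_mem hs,
      Set.indicator_of_mem (Set.Ioo_subset_Ioc_self hs)]
    rw [lintegral_sub_left_eq_self fun y => ‖heatKernel d (t - s) y‖ₑ ^ q,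
      lintegral_heatKernel_rpow (sub_pos.2 hs.2) hq]
  · have hzero : ∀ y, mildKernel t x s y = 0 := fun y =>
      Set.indicator_apply_eq_zero.2 fun hs' => heatKernel_of_nonpos
        (sub_nonpos.2 (not_lt.1 fun hst => hs ⟨hs'.1, hst⟩)) _
    simp [hzero, hs, hq]

lemma lintegral_sub_rpow {t a : ℝ} (ht : 0 ≤ t) (ha : -1 < a) :
    ∫⁻ s in Set.Ioo 0 t, ENNReal.ofReal ((t - s) ^ a)
      = ENNReal.ofReal (t ^ (a + 1) / (a + 1)) := by
  have hint : IntervalIntegrable (fun s => (t - s) ^ a) volume 0 t := by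
    simpa using
      (intervalIntegral.intervalIntegrable_rpow' (a := t) (b := 0) ha).comp_sub_left t
  rw [restrict_Ioo_eq_restrict_Ioc, ← ofReal_integral_eq_lintegral_ofReal
    ((intervalIntegrable_iff_integrableOn_Ioc_of_le ht).1 hint)
    ((ae_restrict_iff' measurableSet_Ioc).2 (ae_of_all _ fun s hs =>
      Real.rpow_nonneg (sub_nonneg.2 hs.2) _)),
    ← intervalIntegral.integral_of_le ht,
    intervalIntegral.integral_comp_sub_left (fun s => s ^ a) t, sub_self, sub_zero,
    integral_rpow (Or.inl ha), Real.zero_rpow (by linarith), sub_zero]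

/-- Lebesgue measure on `(0, ∞) × ℝ^d`, as a measure on `ℝ × ℝ^d` carried by positive times. -/
abbrev spaceTime (d : ℕ) : Measure (ℝ × Space d) :=
  ((volume : Measure ℝ).restrict (Set.Ioi 0)).prod volume

lemma eLpNorm_mildKernel {t q : ℝ} (ht : 0 ≤ t) (hq : 0 < q) (hqd : d * (q - 1) < 2)
    (x : Space d) :
    eLpNorm (fun z => mildKernel t x z.1 z.2) (ENNReal.ofReal q) (spaceTime d)
      = ENNReal.ofReal ((heatConst d q * (t ^ (1 - d / 2 * (q - 1) : ℝ)
        / (1 - d / 2 * (q - 1) : ℝ))) ^ q⁻¹) := by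
  have hconst := (heatConst_pos d hq).le
  have hmeas := measurable_mildKernel t x
  have ha : (-1 : ℝ) < -(d / 2 * (q - 1)) := by linarith
  have hlint : ∫⁻ z, ‖mildKernel t x z.1 z.2‖ₑ ^ q ∂spaceTime d = ENNReal.ofReal
      (heatConst d q * (t ^ (1 - d / 2 * (q - 1) : ℝ) / (1 - d / 2 * (q - 1) : ℝ))) := by
    rw [lintegral_prod _ (by fun_prop)]
    simp_rw [lintegral_mildKernel_rpow_space hq, ENNReal.ofReal_mul hconst]
    rw [lintegral_indicator measurableSet_Ioo, Measure.restrict_restrict measurableSet_Ioo,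
      Set.inter_eq_left.2 fun s hs => hs.1, lintegral_const_mul _ (by fun_prop),
      lintegral_sub_rpow ht ha, neg_add_eq_sub]
  rw [eLpNorm_eq_lintegral_rpow_enorm_toReal (by simpa using hq) ENNReal.ofReal_ne_top,
    ENNReal.toReal_ofReal hq.le, hlint, one_div, ENNReal.ofReal_rpow_of_nonneg
      (mul_nonneg hconst (div_nonneg (by positivity) (by linarith))) (by positivity)]

lemma eLpNorm_one_mildKernel {t : ℝ} (ht : 0 ≤ t) (x : Space d) :
    eLpNorm (fun z => mildKernel t x z.1 z.2) 1 (spaceTime d) = ENNReal.ofReal t := by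
  simpa using eLpNorm_mildKernel ht one_pos (by simp) x

lemma integrable_mildKernel {t : ℝ} (ht : 0 ≤ t) (x : Space d) :
    Integrable (fun z => mildKernel t x z.1 z.2) (spaceTime d) :=
  memLp_one_iff_integrable.1 ⟨(measurable_mildKernel t x).aestronglyMeasurable,
    (eLpNorm_one_mildKernel ht x).trans_lt ENNReal.ofReal_lt_top⟩

lemma integral_mildKernel {t : ℝ} (ht : 0 ≤ t) (x : Space d) :
    ∫ z, mildKernel t x z.1 z.2 ∂spaceTime d = t := by
  have h := eLpNorm_one_mildKernel ht x
  simp_rw [eLpNorm_one_eq_lintegral_enorm, Real.enorm_eq_ofReal (mildKernel_nonneg _ _ _ _)] at h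
  rw [integral_eq_lintegral_of_nonneg_ae (ae_of_all _ fun z => mildKernel_nonneg _ _ _ _)
    (measurable_mildKernel t x).aestronglyMeasurable, h, ENNReal.toReal_ofReal ht]

end HeatKernel

section AveragedKernel

variable {d : ℕ} {lam : Measure ℝ}

/-- The function of a jump at `(s, y)` of size `z` whose integral against the jump measure is the
random part of the time average `Y(t, x) / t`. -/
def averagedKernel (t : ℝ) (x : Space d) (z : ℝ × Space d × ℝ) : ℝ :=
  t⁻¹ * (mildKernel t x z.1 z.2.1 * z.2.2)

lemma measurable_averagedKernel (t : ℝ) (x : Space d) : Measurable (averagedKernel t x) :=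
  (((measurable_mildKernel t x).comp (f := fun z : ℝ × Space d × ℝ => (z.1, z.2.1))
    (by fun_prop)).mul (by fun_prop)).const_mul _

variable [SigmaFinite lam]

lemma measurePreserving_prodAssoc_intensity :
    MeasurePreserving MeasurableEquiv.prodAssoc ((spaceTime d).prod lam) (intensity d lam) :=
  measurePreserving_prodAssoc _ _ _

lemma eLpNorm_averagedKernel_eq_mul {p : ℝ≥0∞} (hp0 : p ≠ 0) (hp : p ≠ ∞) (t : ℝ) (x : Space d) :
    eLpNorm (averagedKernel t x) p (intensity d lam)
      = ‖t⁻¹‖ₑ * (eLpNorm (fun z => mildKernel t x z.1 z.2) p (spaceTime d)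
        * eLpNorm id p lam) := by
  have hcomp : averagedKernel t x ∘ MeasurableEquiv.prodAssoc
      = t⁻¹ • fun z : (ℝ × Space d) × ℝ => mildKernel t x z.1.1 z.1.2 * id z.2 := rfl
  rw [← eLpNorm_comp_measurePreserving (measurable_averagedKernel t x).aestronglyMeasurable
      measurePreserving_prodAssoc_intensity, hcomp, eLpNorm_const_smul,
    ← eLpNorm_mul_prod (measurable_mildKernel t x).aestronglyMeasurable
      aestronglyMeasurable_id hp0 hp]

lemma eLpNorm_averagedKernel {t q : ℝ} (ht : 0 < t) (hq : 0 < q) (hqd : d * (q - 1) < 2)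
    (x : Space d) :
    eLpNorm (averagedKernel t x) (ENNReal.ofReal q) (intensity d lam)
      = ENNReal.ofReal ((heatConst d q / (1 - d / 2 * (q - 1) : ℝ)) ^ q⁻¹
        * t ^ (-((d / 2 + 1) * (1 - q⁻¹)) : ℝ)) * eLpNorm id (ENNReal.ofReal q) lam := by
  have hden : 0 < 1 - (d / 2 * (q - 1) : ℝ) := by linarith
  have hconst : 0 ≤ heatConst d q / (1 - d / 2 * (q - 1) : ℝ) :=
    (div_pos (heatConst_pos d hq) hden).le
  rw [eLpNorm_averagedKernel_eq_mul (by simpa using hq) ENNReal.ofReal_ne_top,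
    eLpNorm_mildKernel ht.le hq hqd, ← mul_assoc, Real.enorm_eq_ofReal (by positivity),
    ← ENNReal.ofReal_mul (by positivity), mul_div_left_comm, mul_comm (t ^ _),
    Real.mul_rpow hconst (by positivity), mul_left_comm, ← Real.rpow_neg_one t,
    ← Real.rpow_mul ht.le, ← Real.rpow_add ht]
  congr 4
  field_simp
  ring

lemma memLp_averagedKernel {t q : ℝ} (ht : 0 < t) (hq : 0 < q) (hqd : d * (q - 1) < 2)
    (hlam : MemLp id (ENNReal.ofReal q) lam) (x : Space d) :
    MemLp (averagedKernel t x) (ENNReal.ofReal q) (intensity d lam) :=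
  ⟨(measurable_averagedKernel t x).aestronglyMeasurable, by
    rw [eLpNorm_averagedKernel ht hq hqd]
    exact ENNReal.mul_lt_top ENNReal.ofReal_lt_top hlam.2⟩

lemma integrable_averagedKernel {t : ℝ} (ht : 0 < t) (hlam : Integrable id lam) (x : Space d) :
    Integrable (averagedKernel t x) (intensity d lam) := by
  rw [← memLp_one_iff_integrable] at hlam ⊢
  simpa using memLp_averagedKernel ht one_pos (by simp) (by simpa using hlam) x

lemma integral_averagedKernel {t : ℝ} (ht : 0 < t) (x : Space d) :
    ∫ z, averagedKernel t x z ∂intensity d lam = ∫ z, z ∂lam := by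
  have hprod : ∫ z, averagedKernel t x z ∂intensity d lam
      = t⁻¹ * ((∫ z, mildKernel t x z.1 z.2 ∂spaceTime d) * ∫ z, z ∂lam) := by
    rw [← integral_prod_mul, ← integral_const_mul,
      ← measurePreserving_prodAssoc_intensity.integral_comp']
    rfl
  rw [hprod, integral_mildKernel ht.le, inv_mul_cancel_left₀ ht.ne']

lemma tendsto_eLpNorm_averagedKernel {q : ℝ} (hq : 1 < q) (hqd : d * (q - 1) < 2)
    (hlam : MemLp id (ENNReal.ofReal q) lam) (x : Space d) :
    Tendsto (fun t => eLpNorm (averagedKernel t x) (ENNReal.ofReal q) (intensity d lam)) atTop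
      (𝓝 0) := by
  have hexp : 0 < (d / 2 + 1) * (1 - q⁻¹) :=
    mul_pos (by positivity) (sub_pos.2 (inv_lt_one_of_one_lt₀ hq))
  have hlim := ENNReal.Tendsto.mul_const (ENNReal.tendsto_ofReal
    ((tendsto_rpow_neg_atTop hexp).const_mul
      ((heatConst d q / (1 - d / 2 * (q - 1) : ℝ)) ^ q⁻¹))) (Or.inr hlam.2.ne)
  rw [mul_zero, ENNReal.ofReal_zero, zero_mul] at hlim
  refine hlim.congr' ?_
  filter_upwards [eventually_gt_atTop 0] with t ht
  exact (eLpNorm_averagedKernel ht (by linarith) hqd x).symm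

end AveragedKernel

lemma mul_min_two_sub_one_lt {d : ℕ} {q : ℝ} (hqd : d * (q - 1) < 2) :
    d * (min q 2 - 1) < 2 :=
  (mul_le_mul_of_nonneg_left (sub_le_sub_right (min_le_left _ _) _) d.cast_nonneg).trans_lt hqd

section MildSolution

variable {Ω : Type*} {d : ℕ} {lam : Measure ℝ} [SigmaFinite lam]
  {μ : Ω → Measure (ℝ × Space d × ℝ)}

-- The drift is chosen so that adding and subtracting the mean of the jump part leaves exactly `m`.
lemma mildSolution_div_sub (m : ℝ) {t : ℝ} (ht : 0 < t) (x : Space d) (ω : Ω) :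
    mildSolution m lam μ t x ω / t - m
      = compensatedIntegral μ (intensity d lam) (averagedKernel t x) ω := by
  rw [compensatedIntegral, integral_averagedKernel ht, mildSolution, noiseIntegral,
    integral_mildKernel ht.le, drift]
  simp only [averagedKernel, integral_const_mul]
  field_simp
  ring

variable [MeasurableSpace Ω] {P : Measure Ω}

lemma ae_noiseIntegrable_mildKernel (hμ : IsPoissonRandomMeasure μ (intensity d lam) P)
    (hlam : Integrable id lam) {t : ℝ} (ht : 0 < t) (x : Space d) :
    ∀ᵐ ω ∂P, NoiseIntegrable (μ ω) (mildKernel t x) := by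
  filter_upwards [hμ.ae_integrable (integrable_averagedKernel ht hlam x)] with ω hω
  exact ⟨integrable_mildKernel ht.le x,
    (integrable_const_mul_iff (isUnit_iff_ne_zero.2 (inv_ne_zero ht.ne')) _).1 hω⟩

variable [IsProbabilityMeasure P]

lemma eLpNorm_mildSolution_div_sub_le (hμ : IsPoissonRandomMeasure μ (intensity d lam) P)
    (hlam : Integrable id lam) (m : ℝ) {p q t : ℝ} (hpq : p ≤ q) (hq : 1 < q) (ht : 0 < t)
    (x : Space d) :
    eLpNorm (fun ω => mildSolution m lam μ t x ω / t - m) (ENNReal.ofReal p) P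
      ≤ ENNReal.ofReal (4 * momentConst q)
        * (eLpNorm (averagedKernel t x) (ENNReal.ofReal q) (intensity d lam)
          + eLpNorm (averagedKernel t x) (ENNReal.ofReal (min q 2)) (intensity d lam)) := by
  have hint := integrable_averagedKernel ht hlam x
  simp_rw [mildSolution_div_sub m ht]
  exact (eLpNorm_le_eLpNorm_of_exponent_le (ENNReal.ofReal_le_ofReal hpq)
    (hμ.aestronglyMeasurable_compensatedIntegral hint.aestronglyMeasurable)).trans
    (hμ.eLpNorm_compensatedIntegral_le (measurable_averagedKernel t x) hint hq)

section Convergence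

variable {p q : ℝ}

lemma memLp_mildSolution_div (hμ : IsPoissonRandomMeasure μ (intensity d lam) P)
    (hlam : Integrable id lam) (hmom : MemLp id (ENNReal.ofReal q) lam) (hpq : p ≤ q) (hq : 1 < q)
    (hqd : d * (q - 1) < 2) (m : ℝ) {t : ℝ} (ht : 0 < t) (x : Space d) :
    MemLp (fun ω => mildSolution m lam μ t x ω / t) (ENNReal.ofReal p) P := by
  have hmin : 1 < min q 2 := lt_min hq one_lt_two
  have hmommin := memLp_of_integrable_of_le hmin.le (min_le_left q 2) hlam hmom
  have hmeas : AEStronglyMeasurable (fun ω => mildSolution m lam μ t x ω / t - m) P := by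
    simp_rw [mildSolution_div_sub m ht]
    exact hμ.aestronglyMeasurable_compensatedIntegral
      (measurable_averagedKernel t x).aestronglyMeasurable
  have hdev : MemLp (fun ω => mildSolution m lam μ t x ω / t - m) (ENNReal.ofReal p) P :=
    ⟨hmeas, (eLpNorm_mildSolution_div_sub_le hμ hlam m hpq hq ht x).trans_lt
      (ENNReal.mul_lt_top ENNReal.ofReal_lt_top (ENNReal.add_lt_top.2
        ⟨(memLp_averagedKernel ht (by linarith) hqd hmom x).2,
          (memLp_averagedKernel ht (by linarith) (mul_min_two_sub_one_lt hqd) hmommin x).2⟩))⟩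
  simpa [Pi.add_def] using hdev.add (memLp_const m)

lemma tendsto_eLpNorm_mildSolution_div_sub (hμ : IsPoissonRandomMeasure μ (intensity d lam) P)
    (hlam : Integrable id lam) (hmom : MemLp id (ENNReal.ofReal q) lam) (hpq : p ≤ q) (hq : 1 < q)
    (hqd : d * (q - 1) < 2) (m : ℝ) (x : Space d) :
    Tendsto (fun t => eLpNorm (fun ω => mildSolution m lam μ t x ω / t - m) (ENNReal.ofReal p) P)
      atTop (𝓝 0) := by
  have hmin : 1 < min q 2 := lt_min hq one_lt_two
  have hmommin := memLp_of_integrable_of_le hmin.le (min_le_left q 2) hlam hmom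
  have hbound := ENNReal.Tendsto.const_mul ((tendsto_eLpNorm_averagedKernel hq hqd hmom x).add
    (tendsto_eLpNorm_averagedKernel hmin (mul_min_two_sub_one_lt hqd) hmommin x))
    (Or.inr (ENNReal.ofReal_ne_top (r := 4 * momentConst q)))
  rw [add_zero, mul_zero] at hbound
  refine tendsto_of_tendsto_of_tendsto_of_le_of_le' tendsto_const_nhds hbound
    (Eventually.of_forall fun _ => zero_le) ?_
  filter_upwards [eventually_gt_atTop 0] with t ht
  exact eLpNorm_mildSolution_div_sub_le hμ hlam m hpq hq ht x

end Convergence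

end MildSolution

lemma exists_one_lt_exponent (d : ℕ) {ε p : ℝ} (hε : 0 < ε) (hpε : p ≤ 1 + ε)
    (hpd : d * (p - 1) < 2) : ∃ q, p ≤ q ∧ 1 < q ∧ q ≤ 1 + ε ∧ d * (q - 1) < 2 := by
  rcases lt_or_ge 1 p with hp | hp
  · exact ⟨p, le_rfl, hp, hpε, hpd⟩
  · have hδ : 0 < 1 / ((d : ℝ) + 1) := by positivity
    have hmin : 0 < min ε (1 / ((d : ℝ) + 1)) := lt_min hε hδ
    have hd : d * min ε (1 / ((d : ℝ) + 1)) ≤ d * (1 / ((d : ℝ) + 1)) := by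
      gcongr
      exact min_le_right _ _
    have hfrac : d * (1 / ((d : ℝ) + 1)) < 2 := by
      rw [mul_one_div, div_lt_iff₀ (by positivity)]
      linarith
    exact ⟨1 + min ε (1 / (d + 1)), by linarith, by linarith,
      by linarith [min_le_left ε (1 / ((d : ℝ) + 1))], by rw [add_sub_cancel_left]; linarith⟩

lemma IsLevyMeasure.sigmaFinite {lam : Measure ℝ} (h : IsLevyMeasure lam) : SigmaFinite lam := by
  refine ⟨⟨⟨fun n : ℕ => {0} ∪ {z : ℝ | 1 / ((n : ℝ) + 1) ≤ ‖min 1 (z ^ 2)‖}, fun _ => trivial,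
    fun n => ?_, Set.eq_univ_of_forall fun z => Set.mem_iUnion.2 ?_⟩⟩⟩
  · refine (measure_union_le _ _).trans_lt ?_
    rw [h.zero, zero_add]
    exact h.integrable.measure_norm_ge_lt_top (by positivity)
  · rcases eq_or_ne z 0 with rfl | hz
    · exact ⟨0, by simp⟩
    · obtain ⟨n, hn⟩ := exists_nat_one_div_lt (norm_pos_iff.2
        (lt_min one_pos (by positivity : 0 < z ^ 2)).ne')
      exact ⟨n, Or.inr hn.le⟩

end LevyHeat

end

theorem mainTheorem4_general {Ω : Type*} [MeasurableSpace Ω] (P : Measure Ω)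
    [IsProbabilityMeasure P] (d : ℕ) (m : ℝ) (lam : Measure ℝ) [SigmaFinite lam]
    (hone : Integrable (fun z : ℝ => |z|) lam)
    (μ : Ω → Measure (ℝ × LevyHeat.Space d × ℝ))
    (hμ : LevyHeat.IsPoissonRandomMeasure μ (LevyHeat.intensity d lam) P)
    (ε : ℝ) (hε : 0 < ε) (hmom : Integrable (fun z : ℝ => |z| ^ (1 + ε)) lam)
    (p : ℝ) (hp : p ∈ Set.Ioc 0 (1 + ε)) (hpd : d * (p - 1) < 2) (x : LevyHeat.Space d) :
    (∀ t : ℝ, 0 < t → ∀ᵐ ω ∂P, LevyHeat.NoiseIntegrable (μ ω) (LevyHeat.mildKernel t x)) ∧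
    (∀ t : ℝ, 0 < t →
      MemLp (fun ω => LevyHeat.mildSolution m lam μ t x ω / t) (ENNReal.ofReal p) P) ∧
    Tendsto
      (fun t : ℝ =>
        eLpNorm (fun ω => LevyHeat.mildSolution m lam μ t x ω / t - m) (ENNReal.ofReal p) P)
      atTop (𝓝 0) := by
  obtain ⟨q, hpq, hq, hqε, hqd⟩ := LevyHeat.exists_one_lt_exponent d hε hp.2 hpd
  have hlam : Integrable id lam := (integrable_norm_iff aestronglyMeasurable_id).1 hone
  have hmomε : MemLp id (ENNReal.ofReal (1 + ε)) lam := by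
    rw [← integrable_norm_rpow_iff aestronglyMeasurable_id (by simpa using by linarith)
      ENNReal.ofReal_ne_top, ENNReal.toReal_ofReal (by linarith)]
    exact hmom
  have hmomq : MemLp id (ENNReal.ofReal q) lam :=
    LevyHeat.memLp_of_integrable_of_le hq.le hqε hlam hmomε
  exact ⟨fun t ht => LevyHeat.ae_noiseIntegrable_mildKernel hμ hlam ht x,
    fun t ht => LevyHeat.memLp_mildSolution_div hμ hlam hmomq hpq hq hqd m ht x,
    LevyHeat.tendsto_eLpNorm_mildSolution_div_sub hμ hlam hmomq hpq hq hqd m x⟩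

theorem mainTheorem4 {Ω : Type*} [MeasurableSpace Ω] (P : Measure Ω) [IsProbabilityMeasure P]
    (d : ℕ) (hd : 1 ≤ d) (m : ℝ) (lam : Measure ℝ)
    (hlevy : LevyHeat.IsLevyMeasure lam) (hne : lam ≠ 0)
    (hone : Integrable (fun z : ℝ => |z|) lam)
    (μ : Ω → Measure (ℝ × LevyHeat.Space d × ℝ))
    (hμ : LevyHeat.IsPoissonRandomMeasure μ (LevyHeat.intensity d lam) P)
    (ε : ℝ) (hε : 0 < ε)
    (hmom : Integrable (fun z : ℝ => |z| ^ (1 + ε)) lam)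
    (hlog : IntegrableOn (fun z : ℝ => z * Real.log |z|) (Set.Icc (-1) 1) lam)
    (p : ℝ) (hp0 : 0 < p) (hpε : p ≤ 1 + ε) (hpd : p < 1 + 2 / (d : ℝ)) :
    (∀ t : ℝ, 0 < t → ∀ᵐ ω ∂P,
      LevyHeat.NoiseIntegrable (μ ω) (LevyHeat.mildKernel t (0 : LevyHeat.Space d))) ∧
    (∀ t : ℝ, 0 < t →
      MemLp (fun ω => LevyHeat.mildSolution m lam μ t 0 ω / t) (ENNReal.ofReal p) P) ∧
    Tendsto
      (fun t : ℝ =>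
        eLpNorm (fun ω => LevyHeat.mildSolution m lam μ t 0 ω / t - m) (ENNReal.ofReal p) P)
      atTop (𝓝 0) := by
  have := hlevy.sigmaFinite
  have hd0 : (0 : ℝ) < d := by exact_mod_cast hd
  exact mainTheorem4_general P d m lam hone μ hμ ε hε hmom p ⟨hp0, hpε⟩
    (mul_comm (d : ℝ) _ ▸ (lt_div_iff₀ hd0).1 (by linarith)) 0
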